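/- Let $n\ge 0$, let $u_0,v_0\in L^2(\mathbb R^n)$, and for $t\in\mathbb R$ let $e^{it\Delta}$ be the free Schrödinger group on $L^2(\mathbb R^n)$, i.e. $\widehat{e^{it\Delta}u_0}(\xi)=e^{-it|\xi|^2}\,\widehat u_0(\xi)$ with $\widehat f(\xi)=(2\pi)^{-n/2}\int_{\mathbb R^n}e^{-ix\cdot\xi}f(x)\,dx$ (extended to $L^2$). Put $$F(t)=\big\|\,|x-y|\,e^{it\Delta}u_0(x)\,e^{it\Delta}v_0(y)\big\|^2_{L^2(\mathbb R^{2n}_{x,y})}\in[0,\infty].$$ Then $F$ is convex on $\mathbb R$ as a function with values in $[0,\infty]$: for all $a,b\in\mathbb R$ and $s\in[0,1]$, $$F((1-s)a+sb)\le(1-s)F(a)+sF(b)\qquad(0\cdot\infty=0).$$ Moreover, if $F$ is finite at two different times, or if $F$ is finite at one time and $\big\||\xi-\eta|\,\widehat u_0(\xi)\,\widehat v_0(\eta)\big\|_{L^2(\mathbb R^{2n}_{\xi,\eta})}<\infty$, then $F(t)<\infty$ for every $t\in\mathbb R$, and $F$ is a convex real-valued function on $\mathbb R$. -/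

import Mathlib

open MeasureTheory FourierTransform
open scoped ENNReal

/-- The symbol of `e^{itΔ}`. With Mathlib's normalization
`𝓕 f ξ = ∫ exp (-2πi x·ξ) f x dx` the operator `Δ` has symbol `-4π²|ξ|²`. -/
noncomputable def schrodingerSymbol {n : ℕ} (t : ℝ) (ξ : EuclideanSpace ℝ (Fin n)) : ℂ :=
  Complex.exp (-(Complex.I * ((4 * Real.pi ^ 2 * t * ‖ξ‖ ^ 2 : ℝ) : ℂ)))

theorem norm_schrodingerSymbol {n : ℕ} (t : ℝ) (ξ : EuclideanSpace ℝ (Fin n)) :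
    ‖schrodingerSymbol t ξ‖ = 1 := by
  rw [schrodingerSymbol, ← mul_neg, ← Complex.ofReal_neg, Complex.norm_exp_I_mul_ofReal]

theorem continuous_schrodingerSymbol {n : ℕ} (t : ℝ) :
    Continuous (schrodingerSymbol (n := n) t) := by
  unfold schrodingerSymbol
  fun_prop

theorem memLp_schrodingerSymbol_mul {n : ℕ} (t : ℝ)
    (g : Lp ℂ 2 (volume : Measure (EuclideanSpace ℝ (Fin n)))) :
    MemLp (fun ξ => schrodingerSymbol t ξ * g ξ) 2 volume := by
  refine (Lp.memLp g).of_le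
    ((continuous_schrodingerSymbol t).aestronglyMeasurable.mul (Lp.aestronglyMeasurable g)) ?_
  filter_upwards with ξ
  rw [norm_mul, norm_schrodingerSymbol, one_mul]

/-- The free Schrödinger evolution `e^{itΔ} u₀` of `u₀ ∈ L²(ℝⁿ)`, that is, the inverse Fourier
transform of the symbol of `e^{itΔ}` times the (Plancherel) Fourier transform of `u₀`. -/
noncomputable def freeSchrodinger {n : ℕ} (t : ℝ)
    (u₀ : Lp ℂ 2 (volume : Measure (EuclideanSpace ℝ (Fin n)))) :
    Lp ℂ 2 (volume : Measure (EuclideanSpace ℝ (Fin n))) :=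
  𝓕⁻ ((memLp_schrodingerSymbol_mul t (𝓕 u₀)).toLp)

/-- The square `‖ |x - y| u(x) v(y) ‖²` of the norm in `L²(ℝⁿ × ℝⁿ)`, a value in `[0, ∞]`. -/
noncomputable def interactionNormSq {n : ℕ}
    (u v : Lp ℂ 2 (volume : Measure (EuclideanSpace ℝ (Fin n)))) : ℝ≥0∞ :=
  eLpNorm (fun p : EuclideanSpace ℝ (Fin n) × EuclideanSpace ℝ (Fin n) =>
    ((‖p.1 - p.2‖ : ℝ) : ℂ) * u p.1 * v p.2) 2 (volume.prod volume) ^ 2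

/-!
Under the Schrödinger flow the position `⟪x, w⟫` becomes, on the Fourier side, the generator of
phase space translations along `((4πt) w, w)`, which is affine in `t`. The norm `‖Q_z x‖` of the
generators `Q_z` of a Weyl system is an extended seminorm in the phase space vector `z`, since the
commutator of two translations of size `h` is a phase of size `h²`. Now `F(t)` is a sum of squares
of such norms of `û₀ ⊗ v̂₀`, one for each component of `x - y`, so `F` is convex. Two points of a
line, or one point and its direction `(w, 0)`, span all of it, whence the finiteness statement.
-/

open Filter Topology TensorProduct Real
open scoped RealInnerProductSpace

theorem enorm_fourierChar_sub_one_le (x : ℝ) : ‖(𝐞 x : ℂ) - 1‖ₑ ≤ ‖2 * π * x‖ₑ := by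
  rw [fourierChar_apply, mul_comm]
  exact enorm_exp_I_mul_ofReal_sub_one_le

theorem limsup_add_le_limsup_add_limsup {ι : Type*} (l : Filter ι) (f g : ι → ℝ≥0∞) :
    limsup (fun i => f i + g i) l ≤ limsup f l + limsup g l := by
  refine ENNReal.le_of_forall_pos_le_add fun ε hε hfin => ?_
  obtain ⟨hf, hg⟩ := ENNReal.add_lt_top.1 hfin
  have hε' : (ε / 2 : ℝ≥0∞) ≠ 0 := (ENNReal.half_pos (ENNReal.coe_pos.2 hε).ne').ne'
  refine limsup_le_of_le (h := ?_)
  filter_upwards [eventually_lt_of_limsup_lt (ENNReal.lt_add_right hf.ne hε'),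
    eventually_lt_of_limsup_lt (ENNReal.lt_add_right hg.ne hε')] with i hfi hgi
  calc f i + g i ≤ (limsup f l + ε / 2) + (limsup g l + ε / 2) := add_le_add hfi.le hgi.le
    _ = limsup f l + limsup g l + ε := by rw [add_add_add_comm, ENNReal.add_halves]

/-- A projective representation of the vector space `Z` by linear isometries of `V`, with
multiplier `exp (2πi form)`: the exponentiated form of the canonical commutation relations. -/
structure WeylSystem (Z V : Type*) [AddCommGroup Z] [Module ℝ Z] [NormedAddCommGroup V]
    [NormedSpace ℂ V] where
  toFun : Z → V →ₗᵢ[ℂ] V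
  form : LinearMap.BilinForm ℝ Z
  apply_add : ∀ z z' x, toFun (z + z') x = 𝐞 (form z z') • toFun z (toFun z' x)

namespace WeylSystem

section Generator

variable {Z V : Type*} [AddCommGroup Z] [Module ℝ Z] [NormedAddCommGroup V] [NormedSpace ℂ V]

instance : CoeFun (WeylSystem Z V) fun _ => Z → V →ₗᵢ[ℂ] V := ⟨toFun⟩

theorem apply_zero (W : WeylSystem Z V) (x : V) : W 0 x = x := by
  refine (W 0).injective ?_
  simpa using (W.apply_add 0 0 x).symm

/-- The norm `‖Q_z x‖`, where `Q_z` is the self-adjoint generator in `W (h z) = exp (2πi h Q_z)`;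
it is `∞` when `x` lies outside the domain of `Q_z`. -/
noncomputable def generatorNorm (W : WeylSystem Z V) (z : Z) (x : V) : ℝ≥0∞ :=
  limsup (fun h : ℝ => ‖W (h • z) x - x‖ₑ / ‖2 * π * h‖ₑ) (𝓝[≠] 0)

theorem enorm_apply_add_sub_le (W : WeylSystem Z V) (z z' : Z) (x : V) :
    ‖W (z + z') x - x‖ₑ ≤
      ‖W z x - x‖ₑ + ‖W z' x - x‖ₑ + ‖2 * π * W.form z z'‖ₑ * ‖x‖ₑ := by
  have telescope : W (z + z') x - x =
      (W z x - x) + W z (W z' x - x) + ((𝐞 (W.form z z') : ℂ) - 1) • W z (W z' x) := by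
    rw [W.apply_add, Circle.smul_def, map_sub, sub_smul, one_smul]
    abel
  calc ‖W (z + z') x - x‖ₑ
      ≤ ‖W z x - x‖ₑ + ‖W z (W z' x - x)‖ₑ +
          ‖((𝐞 (W.form z z') : ℂ) - 1) • W z (W z' x)‖ₑ := by
        rw [telescope]; exact enorm_add₃_le
    _ ≤ _ := by
        simp only [LinearIsometry.enorm_map, enorm_smul]
        gcongr
        exact enorm_fourierChar_sub_one_le _

theorem generatorNorm_add_le (W : WeylSystem Z V) (z z' : Z) (x : V) :
    W.generatorNorm (z + z') x ≤ W.generatorNorm z x + W.generatorNorm z' x := by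
  -- The commutator contributes a phase which is quadratic in `h`.
  have quotient_le (h : ℝ) (hh : h ≠ 0) : ‖W (h • (z + z')) x - x‖ₑ / ‖2 * π * h‖ₑ ≤
      ‖W (h • z) x - x‖ₑ / ‖2 * π * h‖ₑ + ‖W (h • z') x - x‖ₑ / ‖2 * π * h‖ₑ +
        ‖h * W.form z z'‖ₑ * ‖x‖ₑ := by
    have hpos : ‖2 * π * h‖ₑ ≠ 0 := by simp [pi_ne_zero, hh]
    have hphase : 2 * π * W.form (h • z) (h • z') = 2 * π * h * (h * W.form z z') := by
      simp only [map_smul, LinearMap.smul_apply, smul_eq_mul]; ring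
    rw [smul_add]
    refine (ENNReal.div_le_div_right (W.enorm_apply_add_sub_le _ _ x) _).trans_eq ?_
    rw [ENNReal.add_div, ENNReal.add_div, hphase, enorm_mul (2 * π * h),
      mul_assoc ‖2 * π * h‖ₑ, mul_comm ‖2 * π * h‖ₑ,
      ENNReal.mul_div_cancel_right hpos enorm_ne_top]
  have phase_tendsto : Tendsto (fun h : ℝ => ‖h * W.form z z'‖ₑ * ‖x‖ₑ) (𝓝[≠] 0) (𝓝 0) := by
    have : Continuous fun h : ℝ => ‖h * W.form z z'‖ₑ := by fun_prop
    have := ENNReal.Tendsto.mul_const (b := ‖x‖ₑ) (this.tendsto 0) (.inr enorm_ne_top)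
    simpa using this.mono_left nhdsWithin_le_nhds
  calc W.generatorNorm (z + z') x
      ≤ limsup (fun h : ℝ => ‖W (h • z) x - x‖ₑ / ‖2 * π * h‖ₑ +
          ‖W (h • z') x - x‖ₑ / ‖2 * π * h‖ₑ + ‖h * W.form z z'‖ₑ * ‖x‖ₑ) (𝓝[≠] 0) :=
        limsup_le_limsup (eventually_mem_nhdsWithin.mono quotient_le)
    _ ≤ limsup (fun h : ℝ => ‖W (h • z) x - x‖ₑ / ‖2 * π * h‖ₑ +
          ‖W (h • z') x - x‖ₑ / ‖2 * π * h‖ₑ) (𝓝[≠] 0) + 0 := by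
        rw [← phase_tendsto.limsup_eq]; exact limsup_add_le_limsup_add_limsup _ _ _
    _ ≤ W.generatorNorm z x + W.generatorNorm z' x := by
        rw [add_zero]; exact limsup_add_le_limsup_add_limsup _ _ _

theorem generatorNorm_smul_le (W : WeylSystem Z V) (c : ℝ) (z : Z) (x : V) :
    W.generatorNorm (c • z) x ≤ ‖c‖ₑ * W.generatorNorm z x := by
  rcases eq_or_ne c 0 with rfl | hc
  · simp [generatorNorm, W.apply_zero]
  have rescale : Tendsto (fun h : ℝ => h * c) (𝓝[≠] 0) (𝓝[≠] 0) :=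
    tendsto_nhdsWithin_iff.2
      ⟨((continuous_mul_const c).tendsto' 0 0 (zero_mul c)).mono_left nhdsWithin_le_nhds,
        eventually_mem_nhdsWithin.mono fun h hh => mul_ne_zero hh hc⟩
  have quotient_eq (h : ℝ) : ‖W (h • c • z) x - x‖ₑ / ‖2 * π * h‖ₑ =
      ‖c‖ₑ * (‖W ((h * c) • z) x - x‖ₑ / ‖2 * π * (h * c)‖ₑ) := by
    have hc' : ‖c‖ₑ ≠ 0 := enorm_ne_zero.2 hc
    rw [smul_smul, ← mul_assoc (2 * π), enorm_mul (2 * π * h), mul_comm _ ‖c‖ₑ, ← mul_div_assoc,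
      ENNReal.mul_div_mul_left _ _ hc' enorm_ne_top]
  calc W.generatorNorm (c • z) x
      = ‖c‖ₑ * limsup ((fun h : ℝ => ‖W (h • z) x - x‖ₑ / ‖2 * π * h‖ₑ) ∘ fun h => h * c)
          (𝓝[≠] 0) := by
        simp only [generatorNorm, quotient_eq]
        exact ENNReal.limsup_const_mul_of_ne_top enorm_ne_top
    _ ≤ ‖c‖ₑ * W.generatorNorm z x := by
        rw [limsup_comp]
        exact mul_le_mul_right (limsup_le_limsup_of_le rescale) _

theorem generatorNorm_add_smul_le (W : WeylSystem Z V) (α β : ℝ) (z z' : Z) (x : V) :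
    W.generatorNorm (α • z + β • z') x ≤
      ‖α‖ₑ * W.generatorNorm z x + ‖β‖ₑ * W.generatorNorm z' x :=
  (W.generatorNorm_add_le _ _ x).trans
    (add_le_add (W.generatorNorm_smul_le _ _ x) (W.generatorNorm_smul_le _ _ x))

theorem generatorNorm_add_smul_lt_top (W : WeylSystem Z V) (α β : ℝ) {z z' : Z} {x : V}
    (hz : W.generatorNorm z x < ∞) (hz' : W.generatorNorm z' x < ∞) :
    W.generatorNorm (α • z + β • z') x < ∞ :=
  (W.generatorNorm_add_smul_le α β z z' x).trans_lt (ENNReal.add_lt_top.2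
    ⟨ENNReal.mul_lt_top enorm_lt_top hz, ENNReal.mul_lt_top enorm_lt_top hz'⟩)

theorem generatorNorm_sq_convex (W : WeylSystem Z V) {α β : ℝ} (hα : 0 ≤ α) (hβ : 0 ≤ β)
    (hαβ : α + β = 1) (z z' : Z) (x : V) :
    W.generatorNorm (α • z + β • z') x ^ 2 ≤
      ENNReal.ofReal α * W.generatorNorm z x ^ 2 +
        ENNReal.ofReal β * W.generatorNorm z' x ^ 2 := by
  have weights : ENNReal.ofReal α + ENNReal.ofReal β = 1 := by
    rw [← ENNReal.ofReal_add hα hβ, hαβ, ENNReal.ofReal_one]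
  calc W.generatorNorm (α • z + β • z') x ^ 2
      ≤ (ENNReal.ofReal α * W.generatorNorm z x + ENNReal.ofReal β * W.generatorNorm z' x) ^ 2 := by
        rw [← enorm_of_nonneg hα, ← enorm_of_nonneg hβ]
        exact pow_le_pow_left' (W.generatorNorm_add_smul_le α β z z' x) 2
    _ ≤ _ := by
        simpa using ENNReal.rpow_arith_mean_le_arith_mean2_rpow _ _ (W.generatorNorm z x)
          (W.generatorNorm z' x) weights one_le_two

theorem generatorNorm_map_eq {Z' V' : Type*} [AddCommGroup Z'] [Module ℝ Z']
    [NormedAddCommGroup V'] [NormedSpace ℂ V'] (W : WeylSystem Z V) (W' : WeylSystem Z' V')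
    (A : V →ₗᵢ[ℂ] V') {z : Z} {z' : Z'} {x : V}
    (intertwines : ∀ h : ℝ, W' (h • z') (A x) = A (W (h • z) x)) :
    W'.generatorNorm z' (A x) = W.generatorNorm z x := by
  simp only [generatorNorm, intertwines, ← map_sub, LinearIsometry.enorm_map]

end Generator

section Constructions

variable {Z Z' V V' : Type*} [AddCommGroup Z] [Module ℝ Z] [AddCommGroup Z'] [Module ℝ Z']

/-- The pullback of a Weyl system along a linear map of the parameter spaces. -/
def comp [NormedAddCommGroup V] [NormedSpace ℂ V] (W : WeylSystem Z V) (f : Z' →ₗ[ℝ] Z) :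
    WeylSystem Z' V where
  toFun z := W (f z)
  form := W.form.compl₁₂ f f
  apply_add z z' x := by rw [map_add, W.apply_add, LinearMap.compl₁₂_apply]

/-- The joint action of two Weyl systems on a tensor product. -/
noncomputable def tensor [NormedAddCommGroup V] [InnerProductSpace ℂ V] [NormedAddCommGroup V']
    [InnerProductSpace ℂ V'] (W : WeylSystem Z V) (W' : WeylSystem Z V') :
    WeylSystem Z (V ⊗[ℂ] V') where
  toFun z := mapIsometry (W z) (W' z)
  form := W.form + W'.form
  apply_add z z' x := by
    induction x with
    | zero => simp
    | add x y hx hy => simp only [map_add, smul_add, hx, hy]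
    | tmul x y =>
      simp only [mapIsometry_apply, map_tmul, LinearIsometry.coe_toLinearMap, W.apply_add,
        W'.apply_add, LinearMap.add_apply, AddChar.map_add_eq_mul, Circle.smul_def, Circle.coe_mul,
        smul_tmul_smul]

end Constructions

end WeylSystem

section MultiplicationGenerator

variable {X : Type*} [MeasurableSpace X] {μ : Measure X}

theorem enorm_complex_ofReal (x : ℝ) : ‖(x : ℂ)‖ₑ = ‖x‖ₑ := by
  rw [← ofReal_norm, Complex.norm_real, ofReal_norm]

theorem tendsto_fourierChar_mul_sub_one_div (z : ℝ) :
    Tendsto (fun h : ℝ => ((2 * π * h : ℝ) : ℂ)⁻¹ * ((𝐞 (h * z) : ℂ) - 1)) (𝓝[≠] 0)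
      (𝓝 (Complex.I * z)) := by
  have hderiv : HasDerivAt (fun h : ℝ => (𝐞 (h * z) : ℂ)) (2 * π * Complex.I * z) 0 := by
    have := (hasDerivAt_fourierChar (0 * z)).scomp 0 (hasDerivAt_mul_const z)
    simpa [mul_comm, mul_left_comm, mul_assoc, Function.comp_def] using this
  have hslope := (hasDerivAt_iff_tendsto_slope_zero.1 hderiv).const_mul ((2 * π : ℂ)⁻¹)
  have hpi : (2 * π : ℂ) ≠ 0 := by simp [pi_ne_zero]
  convert hslope using 2 with h
  · simp [mul_assoc, mul_comm, mul_left_comm]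
  · rw [← mul_assoc, ← mul_assoc, inv_mul_cancel₀ hpi, one_mul]

theorem eLpNorm_fourierChar_sub_one_mul_le (z : X → ℝ) (U : X → ℂ) (h : ℝ) (p : ℝ≥0∞) :
    eLpNorm (fun x => ((𝐞 (h * z x) : ℂ) - 1) * U x) p μ ≤
      ‖2 * π * h‖ₑ * eLpNorm (fun x => (z x : ℂ) * U x) p μ := by
  rw [← eLpNorm_const_smul]
  refine eLpNorm_mono_enorm fun x => ?_
  calc ‖((𝐞 (h * z x) : ℂ) - 1) * U x‖ₑ
      ≤ ‖2 * π * (h * z x)‖ₑ * ‖U x‖ₑ := by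
        rw [enorm_mul]; gcongr; exact enorm_fourierChar_sub_one_le _
    _ = ‖((2 * π * h) • fun x => (z x : ℂ) * U x) x‖ₑ := by
        rw [Pi.smul_apply, enorm_smul, enorm_mul (z x : ℂ), enorm_complex_ofReal,
          ← mul_assoc (2 * π), enorm_mul (2 * π * h), mul_assoc ‖2 * π * h‖ₑ]

theorem eLpNorm_mul_le_limsup_fourierChar_sub_one {z : X → ℝ} (hz : Measurable z) {U : X → ℂ}
    (hU : AEStronglyMeasurable U μ) (p : ℝ≥0∞) :
    eLpNorm (fun x => (z x : ℂ) * U x) p μ ≤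
      limsup (fun h : ℝ => eLpNorm (fun x => ((𝐞 (h * z x) : ℂ) - 1) * U x) p μ / ‖2 * π * h‖ₑ)
        (𝓝[≠] 0) := by
  obtain ⟨ε, hε⟩ := exists_seq_tendsto (𝓝[≠] (0 : ℝ))
  let D (h : ℝ) (x : X) : ℂ := ((2 * π * h : ℝ) : ℂ)⁻¹ * ((𝐞 (h * z x) : ℂ) - 1) * U x
  have D_measurable (h : ℝ) : AEStronglyMeasurable (D h) μ := by
    have char_measurable : Measurable fun x => (𝐞 (h * z x) : ℂ) :=
      (continuous_subtype_val.comp continuous_fourierChar).measurable.comp (hz.const_mul h)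
    exact ((char_measurable.sub_const 1).const_mul _).aestronglyMeasurable.mul hU
  have D_tendsto (x : X) : Tendsto (fun k => D (ε k) x) atTop (𝓝 (Complex.I * z x * U x)) :=
    ((tendsto_fourierChar_mul_sub_one_div (z x)).comp hε).mul_const _
  have D_norm : ∀ᶠ h in 𝓝[≠] (0 : ℝ), eLpNorm (D h) p μ =
      eLpNorm (fun x => ((𝐞 (h * z x) : ℂ) - 1) * U x) p μ / ‖2 * π * h‖ₑ := by
    filter_upwards [self_mem_nhdsWithin] with h hh
    have hne : ((2 * π * h : ℝ) : ℂ) ≠ 0 := by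
      exact_mod_cast mul_ne_zero (mul_ne_zero two_ne_zero pi_ne_zero) hh
    have : D h = ((2 * π * h : ℝ) : ℂ)⁻¹ • fun x => ((𝐞 (h * z x) : ℂ) - 1) * U x := by
      ext x; exact mul_assoc _ _ _
    rw [this, eLpNorm_const_smul, enorm_inv hne, enorm_complex_ofReal, mul_comm, div_eq_mul_inv]
  calc eLpNorm (fun x => (z x : ℂ) * U x) p μ
      = eLpNorm (fun x => Complex.I * z x * U x) p μ :=
        eLpNorm_congr_norm_ae (.of_forall fun x => by simp)
    _ ≤ liminf (fun k => eLpNorm (D (ε k)) p μ) atTop :=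
        Lp.eLpNorm_lim_le_liminf_eLpNorm (fun k => D_measurable _) _ (.of_forall D_tendsto)
    _ ≤ limsup ((fun h => eLpNorm (D h) p μ) ∘ ε) atTop := liminf_le_limsup
    _ ≤ limsup (fun h => eLpNorm (D h) p μ) (𝓝[≠] 0) := by
        rw [limsup_comp]; exact limsup_le_limsup_of_le hε
    _ = _ := limsup_congr D_norm

theorem limsup_eLpNorm_fourierChar_sub_one_mul {z : X → ℝ} (hz : Measurable z) {U : X → ℂ}
    (hU : AEStronglyMeasurable U μ) (p : ℝ≥0∞) :
    limsup (fun h : ℝ => eLpNorm (fun x => ((𝐞 (h * z x) : ℂ) - 1) * U x) p μ / ‖2 * π * h‖ₑ)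
      (𝓝[≠] 0) = eLpNorm (fun x => (z x : ℂ) * U x) p μ :=
  le_antisymm
    (limsup_le_of_le (h := .of_forall fun h =>
      ENNReal.div_le_of_le_mul' (eLpNorm_fourierChar_sub_one_mul_le z U h p)))
    (eLpNorm_mul_le_limsup_fourierChar_sub_one hz hU p)

end MultiplicationGenerator

section PhaseMultiplication

variable {X : Type*} [MeasurableSpace X] {μ : Measure X} {p : ℝ≥0∞}

theorem memLp_fourierChar_smul {θ : X → ℝ} (hθ : Measurable θ) (g : Lp ℂ p μ) :
    MemLp (fun x => 𝐞 (θ x) • g x) p μ := by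
  have char_measurable : Measurable fun x => (𝐞 (θ x) : ℂ) :=
    (continuous_subtype_val.comp continuous_fourierChar).measurable.comp hθ
  exact (Lp.memLp g).of_le (char_measurable.aestronglyMeasurable.mul (Lp.aestronglyMeasurable g))
    (.of_forall fun x => (Circle.norm_smul _ _).le)

/-- Multiplication by the unimodular function `exp (2πi θ)` on `Lᵖ`. -/
noncomputable def phaseMul [Fact (1 ≤ p)] (θ : X → ℝ) (hθ : Measurable θ) :
    Lp ℂ p μ →ₗᵢ[ℂ] Lp ℂ p μ where
  toFun g := (memLp_fourierChar_smul hθ g).toLp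
  map_add' f g := by
    rw [← MemLp.toLp_add]
    refine MemLp.toLp_congr _ _ ?_
    filter_upwards [Lp.coeFn_add f g] with x hx
    rw [hx, Pi.add_apply, Pi.add_apply, smul_add]
  map_smul' c g := by
    rw [RingHom.id_apply, ← MemLp.toLp_const_smul]
    refine MemLp.toLp_congr _ _ ?_
    filter_upwards [Lp.coeFn_smul c g] with x hx
    rw [hx, Pi.smul_apply, Pi.smul_apply, smul_comm]
  norm_map' g := by
    refine (Lp.norm_toLp _ (memLp_fourierChar_smul hθ g)).trans ?_
    rw [Lp.norm_def]
    congr 1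
    exact eLpNorm_congr_norm_ae (.of_forall fun x => Circle.norm_smul _ _)

theorem coeFn_phaseMul [Fact (1 ≤ p)] {θ : X → ℝ} (hθ : Measurable θ) (g : Lp ℂ p μ) :
    phaseMul θ hθ g =ᵐ[μ] fun x => 𝐞 (θ x) • g x :=
  MemLp.coeFn_toLp (memLp_fourierChar_smul hθ g)

end PhaseMultiplication

section PhaseSpace

variable {E : Type*} [NormedAddCommGroup E] [InnerProductSpace ℝ E] [FiniteDimensional ℝ E]
  [MeasurableSpace E] [BorelSpace E]

/-- Translation by the point `z = (p, q)` of phase space, `q` being the displacement in position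
and `p` the one in momentum. The phase `-⟪p, q⟫ / 2` is Weyl's symmetric ordering, which makes
`h ↦ weylTranslation (h • z)` a one-parameter group. -/
noncomputable def weylTranslation (z : E × E) :
    Lp ℂ 2 (volume : Measure E) →ₗᵢ[ℂ] Lp ℂ 2 (volume : Measure E) :=
  (phaseMul (fun x => ⟪x, z.1⟫ - ⟪z.1, z.2⟫ / 2) (by fun_prop)).comp
    (Lp.compMeasurePreservingₗᵢ ℂ (fun x => x - z.2) (measurePreserving_sub_right volume z.2))

theorem coeFn_weylTranslation (z : E × E) (g : Lp ℂ 2 (volume : Measure E)) :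
    weylTranslation z g =ᵐ[volume]
      fun x => 𝐞 (⟪x, z.1⟫ - ⟪z.1, z.2⟫ / 2) • g (x - z.2) := by
  filter_upwards [coeFn_phaseMul (p := 2) (θ := fun x => ⟪x, z.1⟫ - ⟪z.1, z.2⟫ / 2) (by fun_prop)
      (Lp.compMeasurePreservingₗᵢ ℂ (fun x => x - z.2) (measurePreserving_sub_right volume z.2) g),
    Lp.coeFn_compMeasurePreserving g (measurePreserving_sub_right volume z.2)] with x hphase htrans
  exact hphase.trans (congrArg _ htrans)

variable (E) in
/-- The Schrödinger representation of phase space on `L²(E)`. -/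
noncomputable def schrodingerRepresentation :
    WeylSystem (E × E) (Lp ℂ 2 (volume : Measure E)) where
  toFun := weylTranslation
  form := (2⁻¹ : ℝ) • ((innerₗ E).compl₁₂ (LinearMap.snd ℝ E E) (LinearMap.fst ℝ E E) -
    (innerₗ E).compl₁₂ (LinearMap.fst ℝ E E) (LinearMap.snd ℝ E E))
  apply_add z z' g := by
    apply Lp.ext
    filter_upwards [coeFn_weylTranslation (z + z') g,
      Lp.coeFn_smul (𝐞 (2⁻¹ * (⟪z.2, z'.1⟫ - ⟪z.1, z'.2⟫)) : ℂ)
        (weylTranslation z (weylTranslation z' g)),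
      coeFn_weylTranslation z (weylTranslation z' g),
      (measurePreserving_sub_right volume z.2).quasiMeasurePreserving.ae
        (coeFn_weylTranslation z' g)] with x hsum hsmul hz hz'
    rw [hsum]
    refine Eq.trans ?_ hsmul.symm
    rw [Pi.smul_apply, hz, hz', ← Circle.smul_def, smul_smul, smul_smul,
      ← AddChar.map_add_eq_mul, ← AddChar.map_add_eq_mul, Prod.snd_add, Prod.fst_add, sub_sub]
    congr 2
    simp only [inner_add_left, inner_add_right, inner_sub_left, real_inner_comm z.2]
    ring

theorem fourierInv_weylTranslation (w : E) (g : Lp ℂ 2 (volume : Measure E)) :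
    𝓕⁻ (weylTranslation (0, w) g) = weylTranslation (w, 0) (𝓕⁻ g) := by
  refine DenseRange.induction_on
    (p := fun g => 𝓕⁻ (weylTranslation (0, w) g) = weylTranslation (w, 0) (𝓕⁻ g))
    (SchwartzMap.denseRange_toLpCLM (p := 2) ENNReal.ofNat_ne_top) g ?_ fun f => ?_
  · exact isClosed_eq
      ((Lp.fourierTransformₗᵢ E ℂ).symm.continuous.comp (weylTranslation (0, w)).continuous)
      ((weylTranslation (w, 0)).continuous.comp (Lp.fourierTransformₗᵢ E ℂ).symm.continuous)
  have translate : weylTranslation (0, w) (f.toLp 2) = (f.compSubConstCLM ℂ w).toLp 2 := by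
    apply Lp.ext
    filter_upwards [coeFn_weylTranslation (0, w) (f.toLp 2),
      (measurePreserving_sub_right volume w).quasiMeasurePreserving.ae
        (SchwartzMap.coeFn_toLp f 2 volume),
      SchwartzMap.coeFn_toLp (f.compSubConstCLM ℂ w) 2 volume] with x h₁ h₂ h₃
    rw [h₁, h₂, h₃]
    simp
  rw [SchwartzMap.toLpCLM_apply, translate, SchwartzMap.toLp_fourierInv_eq,
    SchwartzMap.toLp_fourierInv_eq]
  apply Lp.ext
  filter_upwards [SchwartzMap.coeFn_toLp (𝓕⁻ (f.compSubConstCLM ℂ w)) 2 volume,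
    coeFn_weylTranslation (w, 0) ((𝓕⁻ f).toLp 2),
    SchwartzMap.coeFn_toLp (𝓕⁻ f) 2 volume] with x h₁ h₂ h₃
  rw [h₁, h₂, inner_zero_right, zero_div, sub_zero, sub_zero, h₃, SchwartzMap.fourierInv_coe,
    SchwartzMap.fourierInv_coe, Real.fourierInv_eq, Real.fourierInv_eq, Circle.smul_def,
    ← integral_smul, ← integral_add_right_eq_self _ w]
  congr 1 with v
  rw [SchwartzMap.compSubConstCLM_apply, add_sub_cancel_right, inner_add_left, real_inner_comm x w,
    add_comm, AddChar.map_add_eq_mul, mul_smul, Circle.smul_def (𝐞 ⟪x, w⟫)]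

/-- Multiplication by the symbol `exp (-4π²i t |ξ|²)` of `e^{itΔ}`. -/
noncomputable def schrodingerMultiplier (t : ℝ) :
    Lp ℂ 2 (volume : Measure E) →ₗᵢ[ℂ] Lp ℂ 2 (volume : Measure E) :=
  phaseMul (fun ξ => -(2 * π * t * ‖ξ‖ ^ 2)) (by fun_prop)

theorem coeFn_schrodingerMultiplier (t : ℝ) (g : Lp ℂ 2 (volume : Measure E)) :
    schrodingerMultiplier t g =ᵐ[volume] fun ξ => 𝐞 (-(2 * π * t * ‖ξ‖ ^ 2)) • g ξ :=
  coeFn_phaseMul (by fun_prop) g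

theorem weylTranslation_schrodingerMultiplier (t : ℝ) (w : E) (g : Lp ℂ 2 (volume : Measure E)) :
    weylTranslation (0, w) (schrodingerMultiplier t g) =
      schrodingerMultiplier t (weylTranslation ((4 * π * t) • w, w) g) := by
  apply Lp.ext
  filter_upwards [coeFn_weylTranslation (0, w) (schrodingerMultiplier t g),
    (measurePreserving_sub_right volume w).quasiMeasurePreserving.ae
      (coeFn_schrodingerMultiplier t g),
    coeFn_schrodingerMultiplier t (weylTranslation ((4 * π * t) • w, w) g),
    coeFn_weylTranslation ((4 * π * t) • w, w) g] with ξ h₁ h₂ h₃ h₄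
  rw [h₁, h₂, h₃, h₄, smul_smul, smul_smul, ← AddChar.map_add_eq_mul, ← AddChar.map_add_eq_mul]
  congr 2
  simp only [inner_zero_left, inner_zero_right, norm_sub_sq_real, real_inner_smul_left,
    real_inner_smul_right, real_inner_self_eq_norm_sq]
  ring

/-- The evolution `e^{itΔ}` as a function of the Fourier transform of the initial datum. -/
noncomputable def schrodingerOfFourier (t : ℝ) :
    Lp ℂ 2 (volume : Measure E) →ₗᵢ[ℂ] Lp ℂ 2 (volume : Measure E) :=
  (Lp.fourierTransformₗᵢ E ℂ).symm.toLinearIsometry.comp (schrodingerMultiplier t)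

-- In the Heisenberg picture the position `⟪x, w⟫` evolves into `⟪x, w⟫ + 4πt ⟪D, w⟫`.
theorem weylTranslation_schrodingerOfFourier (t : ℝ) (w : E) (g : Lp ℂ 2 (volume : Measure E)) :
    weylTranslation (w, 0) (schrodingerOfFourier t g) =
      schrodingerOfFourier t (weylTranslation ((4 * π * t) • w, w) g) :=
  (fourierInv_weylTranslation w _).symm.trans
    (congrArg 𝓕⁻ (weylTranslation_schrodingerMultiplier t w g))

end PhaseSpace

section TensorProductOfFunctions

variable {X Y : Type*} [MeasurableSpace X] [MeasurableSpace Y] {μ : Measure X} {ν : Measure Y}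

theorem stronglyMeasurable_mul_prod (u : Lp ℂ 2 μ) (v : Lp ℂ 2 ν) :
    StronglyMeasurable fun q : X × Y => u q.1 * v q.2 :=
  ((Lp.stronglyMeasurable u).comp_measurable measurable_fst).mul
    ((Lp.stronglyMeasurable v).comp_measurable measurable_snd)

theorem eLpNorm_two_sq {F : Type*} [NormedAddCommGroup F] (μ : Measure X) (f : X → F) :
    eLpNorm f 2 μ ^ 2 = ∫⁻ x, ‖f x‖ₑ ^ 2 ∂μ := by
  simpa using eLpNorm_nnreal_pow_eq_lintegral (f := f) (μ := μ) (two_ne_zero : (2 : NNReal) ≠ 0)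

theorem memLp_mul_prod [SFinite ν] (u : Lp ℂ 2 μ) (v : Lp ℂ 2 ν) :
    MemLp (fun q : X × Y => u q.1 * v q.2) 2 (μ.prod ν) := by
  refine ⟨(stronglyMeasurable_mul_prod u v).aestronglyMeasurable,
    (ENNReal.pow_lt_top_iff.1 ?_).resolve_right two_ne_zero⟩
  have factor : eLpNorm (fun q : X × Y => u q.1 * v q.2) 2 (μ.prod ν) ^ 2 =
      eLpNorm u 2 μ ^ 2 * eLpNorm v 2 ν ^ 2 := by
    simp only [eLpNorm_two_sq, enorm_mul, mul_pow]
    exact lintegral_prod_mul ((Lp.stronglyMeasurable u).enorm.pow_const 2).aemeasurable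
      ((Lp.stronglyMeasurable v).enorm.pow_const 2).aemeasurable
  rw [factor]
  exact ENNReal.mul_lt_top (ENNReal.pow_lt_top (Lp.eLpNorm_lt_top u))
    (ENNReal.pow_lt_top (Lp.eLpNorm_lt_top v))

theorem inner_toLp_mul_prod [SFinite μ] [SFinite ν] (u u' : Lp ℂ 2 μ) (v v' : Lp ℂ 2 ν) :
    inner ℂ (memLp_mul_prod u v).toLp (memLp_mul_prod u' v').toLp =
      inner ℂ (u ⊗ₜ[ℂ] v) (u' ⊗ₜ[ℂ] v') := by
  rw [inner_tmul, L2.inner_def, L2.inner_def, L2.inner_def, ← integral_prod_mul]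
  refine integral_congr_ae ?_
  filter_upwards [(memLp_mul_prod u v).coeFn_toLp, (memLp_mul_prod u' v').coeFn_toLp] with q h h'
  rw [h, h']
  simp only [RCLike.inner_apply, map_mul]
  ring

theorem enorm_tmul_sub_tmul [SFinite μ] [SFinite ν] (u u' : Lp ℂ 2 μ) (v v' : Lp ℂ 2 ν) :
    ‖u ⊗ₜ[ℂ] v - u' ⊗ₜ[ℂ] v'‖ₑ =
      eLpNorm (fun q : X × Y => u q.1 * v q.2 - u' q.1 * v' q.2) 2 (μ.prod ν) := by
  have norm_eq : ‖u ⊗ₜ[ℂ] v - u' ⊗ₜ[ℂ] v'‖ =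
      ‖(memLp_mul_prod u v).toLp - (memLp_mul_prod u' v').toLp‖ := by
    simp only [norm_eq_sqrt_re_inner (𝕜 := ℂ), inner_sub_left, inner_sub_right,
      inner_toLp_mul_prod]
  rw [← ofReal_norm, norm_eq, ofReal_norm, ← MemLp.toLp_sub, Lp.enorm_toLp]
  rfl

end TensorProductOfFunctions

section EvolvedPosition

variable {E : Type*} [AddCommGroup E] [Module ℝ E]

/-- The Fourier side direction in phase space of the position `⟪x, w⟫` at time `t`. -/
noncomputable def evolvedPosition (w : E) (t : ℝ) : E × E := ((4 * π * t) • w, w)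

theorem smul_evolvedPosition (h : ℝ) (w : E) (t : ℝ) :
    h • evolvedPosition w t = evolvedPosition (h • w) t := by
  rw [evolvedPosition, evolvedPosition, Prod.smul_mk, smul_comm]

theorem evolvedPosition_combination {α β : ℝ} (hαβ : α + β = 1) (w : E) (a b : ℝ) :
    evolvedPosition w (α * a + β * b) = α • evolvedPosition w a + β • evolvedPosition w b := by
  refine Prod.ext ?_ ?_
  · simp only [evolvedPosition, Prod.fst_add, Prod.smul_fst]
    module
  · simp only [evolvedPosition, Prod.snd_add, Prod.smul_snd, ← add_smul, hαβ, one_smul]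

theorem evolvedPosition_eq_add (w : E) (a t : ℝ) :
    evolvedPosition w t = (1 : ℝ) • evolvedPosition w a + (4 * π * (t - a)) • (w, (0 : E)) := by
  refine Prod.ext ?_ ?_
  · simp only [evolvedPosition, Prod.fst_add, Prod.smul_fst]
    module
  · simp [evolvedPosition]

end EvolvedPosition

section RelativePosition

variable {E : Type*} [NormedAddCommGroup E] [InnerProductSpace ℝ E] [FiniteDimensional ℝ E]
  [MeasurableSpace E] [BorelSpace E]

variable (E) in
/-- The two-particle Weyl system moving the particles by opposite phase space vectors. Its
generator in the direction `(w, 0)` is the component `⟪x - y, w⟫` of the relative position. -/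
noncomputable def relativeRepresentation :
    WeylSystem (E × E) (Lp ℂ 2 (volume : Measure E) ⊗[ℂ] Lp ℂ 2 (volume : Measure E)) :=
  (schrodingerRepresentation E).tensor ((schrodingerRepresentation E).comp (-LinearMap.id))

theorem relativeRepresentation_tmul (z : E × E) (u v : Lp ℂ 2 (volume : Measure E)) :
    relativeRepresentation E z (u ⊗ₜ v) = weylTranslation z u ⊗ₜ weylTranslation (-z) v :=
  rfl

theorem enorm_relativeRepresentation_tmul_sub (h : ℝ) (w : E)
    (u v : Lp ℂ 2 (volume : Measure E)) :
    ‖relativeRepresentation E (h • (w, 0)) (u ⊗ₜ v) - u ⊗ₜ v‖ₑ =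
      eLpNorm (fun q : E × E => ((𝐞 (h * ⟪q.1 - q.2, w⟫) : ℂ) - 1) * (u q.1 * v q.2)) 2
        (volume.prod volume) := by
  rw [relativeRepresentation_tmul, enorm_tmul_sub_tmul]
  refine eLpNorm_congr_ae ?_
  filter_upwards [
    Measure.quasiMeasurePreserving_fst.ae (coeFn_weylTranslation (h • (w, (0 : E))) u),
    Measure.quasiMeasurePreserving_snd.ae (coeFn_weylTranslation (-(h • (w, (0 : E)))) v)]
    with q hu hv
  have phase_eq : h * ⟪q.1 - q.2, w⟫ = h * ⟪q.1, w⟫ + -(h * ⟪q.2, w⟫) := by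
    rw [inner_sub_left]; ring
  rw [hu, hv, phase_eq, AddChar.map_add_eq_mul]
  simp only [Prod.smul_fst, Prod.smul_snd, Prod.fst_neg, Prod.snd_neg, smul_zero, neg_zero,
    sub_zero, inner_zero_right, zero_div, inner_neg_right, real_inner_smul_right, Circle.smul_def,
    smul_eq_mul, Circle.coe_mul]
  ring

theorem generatorNorm_relativePosition (w : E) (u v : Lp ℂ 2 (volume : Measure E)) :
    (relativeRepresentation E).generatorNorm (w, 0) (u ⊗ₜ v) =
      eLpNorm (fun q : E × E => (⟪q.1 - q.2, w⟫ : ℂ) * (u q.1 * v q.2)) 2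
        (volume.prod volume) := by
  simp only [WeylSystem.generatorNorm, enorm_relativeRepresentation_tmul_sub]
  exact limsup_eLpNorm_fourierChar_sub_one_mul (by fun_prop)
    (stronglyMeasurable_mul_prod u v).aestronglyMeasurable 2

theorem relativeRepresentation_schrodingerOfFourier (t : ℝ) (w : E)
    (g k : Lp ℂ 2 (volume : Measure E)) :
    relativeRepresentation E (w, 0) (schrodingerOfFourier t g ⊗ₜ schrodingerOfFourier t k) =
      mapIsometry (schrodingerOfFourier t) (schrodingerOfFourier t)
        (relativeRepresentation E (evolvedPosition w t) (g ⊗ₜ k)) := by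
  have backward : -evolvedPosition w t = ((4 * π * t) • -w, -w) := by
    rw [evolvedPosition, Prod.neg_mk, smul_neg]
  rw [relativeRepresentation_tmul, relativeRepresentation_tmul, mapIsometry_apply, map_tmul,
    Prod.neg_mk, neg_zero, weylTranslation_schrodingerOfFourier,
    weylTranslation_schrodingerOfFourier, backward]
  rfl

theorem generatorNorm_schrodingerOfFourier (t : ℝ) (w : E) (g k : Lp ℂ 2 (volume : Measure E)) :
    (relativeRepresentation E).generatorNorm (w, 0)
        (schrodingerOfFourier t g ⊗ₜ schrodingerOfFourier t k) =
      (relativeRepresentation E).generatorNorm (evolvedPosition w t) (g ⊗ₜ k) := by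
  have intertwines (h : ℝ) : relativeRepresentation E (h • (w, 0))
      (mapIsometry (schrodingerOfFourier t) (schrodingerOfFourier t) (g ⊗ₜ k)) =
        mapIsometry (schrodingerOfFourier t) (schrodingerOfFourier t)
          (relativeRepresentation E (h • evolvedPosition w t) (g ⊗ₜ k)) := by
    rw [smul_evolvedPosition, ← relativeRepresentation_schrodingerOfFourier, Prod.smul_mk,
      smul_zero, mapIsometry_apply, map_tmul]
    rfl
  rw [← (relativeRepresentation E).generatorNorm_map_eq _ _ intertwines, mapIsometry_apply,
    map_tmul]
  rfl

end RelativePosition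

section Interaction

variable {n : ℕ}

local notation "𝔼" => EuclideanSpace ℝ (Fin n)
local notation "L2" => Lp ℂ 2 (volume : Measure 𝔼)

theorem enorm_sq_eq_sum_enorm_inner_sq (x : 𝔼) :
    ‖x‖ₑ ^ 2 = ∑ j, ‖⟪x, EuclideanSpace.single j (1 : ℝ)⟫‖ₑ ^ 2 := by
  have norm_sq : ‖x‖ ^ 2 = ∑ j, ‖⟪x, EuclideanSpace.single j (1 : ℝ)⟫‖ ^ 2 := by
    simpa [EuclideanSpace.inner_single_right] using EuclideanSpace.norm_sq_eq x
  simp only [← ofReal_norm, ← ENNReal.ofReal_pow (norm_nonneg _)]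
  rw [norm_sq, ENNReal.ofReal_sum_of_nonneg fun _ _ => by positivity]

theorem interactionNormSq_eq_sum (u v : L2) :
    interactionNormSq u v =
      ∑ j, (relativeRepresentation 𝔼).generatorNorm (EuclideanSpace.single j 1, 0)
        (u ⊗ₜ v) ^ 2 := by
  simp only [generatorNorm_relativePosition, interactionNormSq, eLpNorm_two_sq]
  have measurable_component (j : Fin n) : Measurable fun q : 𝔼 × 𝔼 =>
      ‖(⟪q.1 - q.2, EuclideanSpace.single j (1 : ℝ)⟫ : ℂ) * (u q.1 * v q.2)‖ₑ ^ 2 :=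
    ((Continuous.stronglyMeasurable (by fun_prop)).mul
      (stronglyMeasurable_mul_prod u v)).enorm.pow_const 2
  rw [← lintegral_finsetSum _ fun j _ => measurable_component j]
  refine lintegral_congr fun q => ?_
  simp only [mul_assoc, enorm_mul _ (_ * _), mul_pow, ← Finset.sum_mul, enorm_complex_ofReal,
    enorm_norm, enorm_sq_eq_sum_enorm_inner_sq]

theorem interactionNormSq_lt_top_iff {u v : L2} :
    interactionNormSq u v < ∞ ↔
      ∀ j, (relativeRepresentation 𝔼).generatorNorm (EuclideanSpace.single j 1, 0)
        (u ⊗ₜ v) < ∞ := by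
  simp [interactionNormSq_eq_sum, ENNReal.sum_lt_top, ENNReal.pow_lt_top_iff]

theorem schrodingerSymbol_eq_fourierChar (t : ℝ) (ξ : 𝔼) :
    schrodingerSymbol t ξ = 𝐞 (-(2 * π * t * ‖ξ‖ ^ 2)) := by
  rw [schrodingerSymbol, fourierChar_apply]
  congr 1
  push_cast
  ring

theorem freeSchrodinger_eq (t : ℝ) (u : L2) :
    freeSchrodinger t u = schrodingerOfFourier t (𝓕 u) := by
  refine congrArg 𝓕⁻ (MemLp.toLp_congr _ (memLp_fourierChar_smul (by fun_prop) _)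
    (.of_forall fun ξ => ?_))
  simp only [schrodingerSymbol_eq_fourierChar, Circle.smul_def, smul_eq_mul]

theorem generatorNorm_freeSchrodinger (t : ℝ) (w : 𝔼) (u v : L2) :
    (relativeRepresentation 𝔼).generatorNorm (w, 0)
        (freeSchrodinger t u ⊗ₜ freeSchrodinger t v) =
      (relativeRepresentation 𝔼).generatorNorm (evolvedPosition w t) (𝓕 u ⊗ₜ 𝓕 v) := by
  rw [freeSchrodinger_eq, freeSchrodinger_eq, generatorNorm_schrodingerOfFourier]

theorem interactionNormSq_freeSchrodinger_convex (u v : L2) {α β : ℝ} (hα : 0 ≤ α) (hβ : 0 ≤ β)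
    (hαβ : α + β = 1) (a b : ℝ) :
    interactionNormSq (freeSchrodinger (α * a + β * b) u) (freeSchrodinger (α * a + β * b) v) ≤
      ENNReal.ofReal α * interactionNormSq (freeSchrodinger a u) (freeSchrodinger a v) +
        ENNReal.ofReal β * interactionNormSq (freeSchrodinger b u) (freeSchrodinger b v) := by
  simp only [interactionNormSq_eq_sum, generatorNorm_freeSchrodinger,
    evolvedPosition_combination hαβ, Finset.mul_sum, ← Finset.sum_add_distrib]
  exact Finset.sum_le_sum fun j _ =>
    (relativeRepresentation 𝔼).generatorNorm_sq_convex hα hβ hαβ _ _ _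

theorem interactionNormSq_lt_top_of_two_times {u v : L2} {a b : ℝ} (hab : a ≠ b)
    (ha : interactionNormSq (freeSchrodinger a u) (freeSchrodinger a v) < ∞)
    (hb : interactionNormSq (freeSchrodinger b u) (freeSchrodinger b v) < ∞) (t : ℝ) :
    interactionNormSq (freeSchrodinger t u) (freeSchrodinger t v) < ∞ := by
  have hba : b - a ≠ 0 := sub_ne_zero.2 hab.symm
  obtain ⟨α, β, hαβ, rfl⟩ : ∃ α β : ℝ, α + β = 1 ∧ α * a + β * b = t :=
    ⟨(b - t) / (b - a), (t - a) / (b - a), by field_simp; ring, by field_simp; ring⟩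
  simp only [interactionNormSq_lt_top_iff, generatorNorm_freeSchrodinger,
    evolvedPosition_combination hαβ] at *
  exact fun j => (relativeRepresentation 𝔼).generatorNorm_add_smul_lt_top α β (ha j) (hb j)

theorem interactionNormSq_lt_top_of_fourier {u v : L2} {a : ℝ}
    (ha : interactionNormSq (freeSchrodinger a u) (freeSchrodinger a v) < ∞)
    (hF : interactionNormSq (𝓕 u) (𝓕 v) < ∞) (t : ℝ) :
    interactionNormSq (freeSchrodinger t u) (freeSchrodinger t v) < ∞ := by
  simp only [interactionNormSq_lt_top_iff, generatorNorm_freeSchrodinger] at *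
  intro j
  rw [evolvedPosition_eq_add _ a t]
  exact (relativeRepresentation 𝔼).generatorNorm_add_smul_lt_top _ _ (ha j) (hF j)

end Interaction

theorem convexOn_toReal {V : Type*} [AddCommGroup V] [Module ℝ V] {F : V → ℝ≥0∞}
    (hF : ∀ x, F x < ∞)
    (hconv : ∀ (x y : V) ⦃α β : ℝ⦄, 0 ≤ α → 0 ≤ β → α + β = 1 →
      F (α • x + β • y) ≤ ENNReal.ofReal α * F x + ENNReal.ofReal β * F y) :
    ConvexOn ℝ Set.univ fun x => (F x).toReal := by
  refine ⟨convex_univ, fun x _ y _ α β hα hβ hαβ => ?_⟩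
  have weighted_ne_top (c : ℝ) (x : V) : ENNReal.ofReal c * F x ≠ ∞ :=
    ENNReal.mul_ne_top ENNReal.ofReal_ne_top (hF x).ne
  have := ENNReal.toReal_mono
    (ENNReal.add_ne_top.2 ⟨weighted_ne_top α x, weighted_ne_top β y⟩) (hconv x y hα hβ hαβ)
  rwa [ENNReal.toReal_add (weighted_ne_top α x) (weighted_ne_top β y), ENNReal.toReal_mul,
    ENNReal.toReal_mul, ENNReal.toReal_ofReal hα, ENNReal.toReal_ofReal hβ] at this

theorem corollary3p5 (n : ℕ)
    (u₀ v₀ : Lp ℂ 2 (volume : Measure (EuclideanSpace ℝ (Fin n)))) :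
    -- convexity on `ℝ` as a function with values in `[0, ∞]`
    (∀ a b s : ℝ, 0 ≤ s → s ≤ 1 →
      interactionNormSq (freeSchrodinger ((1 - s) * a + s * b) u₀)
          (freeSchrodinger ((1 - s) * a + s * b) v₀) ≤
        ENNReal.ofReal (1 - s) * interactionNormSq (freeSchrodinger a u₀) (freeSchrodinger a v₀) +
        ENNReal.ofReal s * interactionNormSq (freeSchrodinger b u₀) (freeSchrodinger b v₀)) ∧
    -- finiteness at all times, and convexity as a real function
    (((∃ t₁ t₂ : ℝ, t₁ ≠ t₂ ∧
          interactionNormSq (freeSchrodinger t₁ u₀) (freeSchrodinger t₁ v₀) < ∞ ∧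
          interactionNormSq (freeSchrodinger t₂ u₀) (freeSchrodinger t₂ v₀) < ∞) ∨
        (∃ t₁ : ℝ, interactionNormSq (freeSchrodinger t₁ u₀) (freeSchrodinger t₁ v₀) < ∞ ∧
          interactionNormSq (𝓕 u₀) (𝓕 v₀) < ∞)) →
      (∀ t : ℝ, interactionNormSq (freeSchrodinger t u₀) (freeSchrodinger t v₀) < ∞) ∧
      ConvexOn ℝ Set.univ (fun t : ℝ =>
        (interactionNormSq (freeSchrodinger t u₀) (freeSchrodinger t v₀)).toReal)) := by
  have convex (a b α β : ℝ) (hα : 0 ≤ α) (hβ : 0 ≤ β) (hαβ : α + β = 1) :=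
    interactionNormSq_freeSchrodinger_convex u₀ v₀ hα hβ hαβ a b
  refine ⟨fun a b s h0 h1 => convex a b _ s (sub_nonneg.2 h1) h0 (sub_add_cancel 1 s),
    fun hfin => ?_⟩
  have finite (t : ℝ) :
      interactionNormSq (freeSchrodinger t u₀) (freeSchrodinger t v₀) < ∞ := by
    rcases hfin with ⟨a, b, hab, ha, hb⟩ | ⟨a, ha, hF⟩
    · exact interactionNormSq_lt_top_of_two_times hab ha hb t
    · exact interactionNormSq_lt_top_of_fourier ha hF t
  exact ⟨finite, convexOn_toReal finite convex⟩
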